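/- **Setting.** Let $S$ be a nonempty set, $\Sigma$ an algebra of subsets of $S$, and $X$ a convex subset of a real vector space. Let $\mathcal F$ be the set of simple acts, i.e. the $\Sigma$-measurable maps $f:S\to X$ with finitely many values; a consequence $x\in X$ is identified with the constant act $x$. Let $B_0(\Sigma)$ be the set of $\Sigma$-measurable functions $S\to\mathbb R$ with finitely many values, and $B_0(\Sigma,T)$ the set of those with values in $T\subseteq\mathbb R$. Let $\Delta$ be the set of finitely additive probabilities on $\Sigma$ with the weak* topology $\sigma(\Delta,B_0(\Sigma))$, and let $\mathscr C$ be the set of lower semicontinuous convex functions $c:\Delta\to(-\infty,\infty]$. A set $C\subseteq\mathscr C$ is *grounded* if $\sup_{c\in C}\min_{p\in\Delta}c(p)=0$, and a function $c\in\mathscr C$ is grounded if $\{c\}$ is, i.e. $\min_{p\in\Delta}c(p)=0$. Let $u:X\to\mathbb R$ be affine and nonconstant, let $c_0\in\mathscr C$ be grounded, and let $\succsim$ be the uncertainty-averse variational preference on $\mathcal F$ represented by $u$ and $c_0$: $$f\succsim g\iff \min_{p\in\Delta}\Big(\int u(f)\,dp+c_0(p)\Big)\ \ge\ \min_{p\in\Delta}\Big(\int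 u(g)\,dp+c_0(p)\Big)\qquad (f,g\in\mathcal F).$$ For $f\in\mathcal F$ let $x_f\in X$ denote a certainty equivalent of $f$, i.e. $x_f\sim f$. Put $$C^*=\Big\{c\in\mathscr C:\ \min_{p\in\Delta}\Big(\int u(f)\,dp+c(p)\Big)\le u(x_f)\ \text{ for all } f\in\mathcal F\Big\},$$ $$B^*=\Big\{b\in\mathscr C:\ \max_{q\in\Delta}\Big(\int u(f)\,dq-b(q)\Big)\ge u(x_f)\ \text{ for all } f\in\mathcal F\Big\}.$$ For $c_1,c_2\in\mathscr C$ write $c_1\underset{u}{\approx}c_2$ if $$\min_{p\in\Delta}\Big(\int\varphi\,dp+c_1(p)\Big)=\min_{p\in\Delta}\Big(\int\varphi\,dp+c_2(p)\Big)\quad\text{for all }\varphi\in B_0(\Sigma,u(X)).$$ **Proposition.** $C^*$ is the greatest (with respect to inclusion) grounded subset $C\subseteq\mathscr C$ such that $\succsim$ is represented by $f\mapsto\max_{c\in C}\min_{p\in\Delta}\big(\int u(f)\,dp+c(p)\big)$, and $$C^*=\Big\{c\in\mathscr C:\ c\underset{u}{\approx}c_1\le c_0\ \text{ for some } c_1\in\mathscr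 C\Big\}.$$ $B^*$ is the greatest grounded subset $B\subseteq\mathscr C$ such that $\succsim$ is represented by $f\mapsto\min_{b\in B}\max_{q\in\Delta}\big(\int u(f)\,dq-b(q)\big)$, and $$B^*=\Big\{b\in\mathscr C:\ \min_{p\in\Delta}\,[\,b(p)+\hat c(p)\,]\le 0\ \text{ for some }\hat c\in\mathscr C\text{ with }\hat c\underset{u}{\approx}c_0\Big\}.$$ -/

import Mathlib

noncomputable section

namespace NiveloidalPref

/-- Mappings `S → Y` with finitely many values that are measurable with respect to the algebra
of events `𝒜`. As there are finitely many values, it is the same to ask for all preimages or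
only for the preimages of points. `SimpleFn 𝒜 ℝ` is the set `B₀(Σ)` and `SimpleFn 𝒜 X` is the
set of simple acts. -/
structure SimpleFn {S : Type*} (𝒜 : BooleanSubalgebra (Set S)) (Y : Type*) where
  toFun : S → Y
  finite_range : (Set.range toFun).Finite
  preimage_mem : ∀ B : Set Y, toFun ⁻¹' B ∈ 𝒜

/-- The constant mapping; a consequence is identified with the constant act. -/
def SimpleFn.const {S : Type*} (𝒜 : BooleanSubalgebra (Set S)) {Y : Type*} (y : Y) :
    SimpleFn 𝒜 Y where
  toFun := fun _ => y
  finite_range := (Set.finite_singleton y).subset (by rintro _ ⟨s, rfl⟩; rfl)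
  preimage_mem := by
    intro B
    by_cases h : y ∈ B
    · have : (fun _ : S => y) ⁻¹' B = ⊤ := by ext s; simp [h]
      rw [this]; exact BooleanSubalgebra.top_mem
    · have : (fun _ : S => y) ⁻¹' B = ⊥ := by ext s; simp [h]
      rw [this]; exact BooleanSubalgebra.bot_mem

/-- The composition `u(f)`. -/
def SimpleFn.comp {S : Type*} {𝒜 : BooleanSubalgebra (Set S)} {Y Z : Type*} (u : Y → Z)
    (f : SimpleFn 𝒜 Y) : SimpleFn 𝒜 Z where
  toFun := u ∘ f.toFun
  finite_range := by rw [Set.range_comp]; exact f.finite_range.image u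
  preimage_mem := fun B => f.preimage_mem (u ⁻¹' B)

/-- The set `Δ` of finitely additive probabilities on the algebra `𝒜`. -/
structure FAProb {S : Type*} (𝒜 : BooleanSubalgebra (Set S)) where
  prob : 𝒜 → ℝ
  nonneg : ∀ A, 0 ≤ prob A
  prob_univ : prob ⊤ = 1
  additive : ∀ A B, Disjoint A B → prob (A ⊔ B) = prob A + prob B

/-- The integral `∫ φ dp` of a simple function. -/
def FAProb.integral {S : Type*} {𝒜 : BooleanSubalgebra (Set S)} (p : FAProb 𝒜)
    (φ : SimpleFn 𝒜 ℝ) : ℝ :=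
  ∑ r ∈ φ.finite_range.toFinset, r * p.prob ⟨φ.toFun ⁻¹' {r}, φ.preimage_mem {r}⟩

/-- The weak* topology `σ(Δ, B₀(Σ))`: the coarsest topology for which `p ↦ ∫ φ dp` is continuous
for every `φ ∈ B₀(Σ)`. -/
instance FAProb.instTopologicalSpace {S : Type*} {𝒜 : BooleanSubalgebra (Set S)} :
    TopologicalSpace (FAProb 𝒜) :=
  ⨅ φ : SimpleFn 𝒜 ℝ, TopologicalSpace.induced (fun p => p.integral φ) inferInstance

/-- The convex combination `a p + (1 - a) q`. -/
def FAProb.mix {S : Type*} {𝒜 : BooleanSubalgebra (Set S)} (a : ℝ) (h0 : 0 ≤ a) (h1 : a ≤ 1)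
    (p q : FAProb 𝒜) : FAProb 𝒜 where
  prob := fun A => a * p.prob A + (1 - a) * q.prob A
  nonneg := fun A =>
    add_nonneg (mul_nonneg h0 (p.nonneg A)) (mul_nonneg (sub_nonneg.2 h1) (q.nonneg A))
  prob_univ := by rw [p.prob_univ, q.prob_univ]; ring
  additive := fun A B h => by rw [p.additive A B h, q.additive A B h]; ring

/-- The set `𝒞` of lower semicontinuous convex functions `c : Δ → (-∞, ∞]`. -/
def Penalties {S : Type*} (𝒜 : BooleanSubalgebra (Set S)) : Set (FAProb 𝒜 → EReal) :=
  {c | (∀ p, c p ≠ ⊥) ∧ LowerSemicontinuous c ∧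
    ∀ (p q : FAProb 𝒜) (a : ℝ) (h0 : 0 < a) (h1 : a < 1),
      c (FAProb.mix a h0.le h1.le p q) ≤ (a : EReal) * c p + ((1 - a : ℝ) : EReal) * c q}

/-- `min_{p ∈ Δ} (∫ φ dp + c(p))`. For `c ∈ 𝒞` the infimum is attained, as `Δ` is compact. -/
def minVal {S : Type*} {𝒜 : BooleanSubalgebra (Set S)} (c : FAProb 𝒜 → EReal)
    (φ : SimpleFn 𝒜 ℝ) : EReal :=
  ⨅ p : FAProb 𝒜, ((p.integral φ : ℝ) : EReal) + c p

/-- `max_{q ∈ Δ} (∫ φ dq - b(q))`. For `b ∈ 𝒞` the supremum is attained, as `Δ` is compact. -/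
def maxVal {S : Type*} {𝒜 : BooleanSubalgebra (Set S)} (b : FAProb 𝒜 → EReal)
    (φ : SimpleFn 𝒜 ℝ) : EReal :=
  ⨆ q : FAProb 𝒜, ((q.integral φ : ℝ) : EReal) - b q

/-- A set `C` of penalties is grounded if `sup_{c ∈ C} min_{p ∈ Δ} c(p) = 0`. -/
def Grounded {S : Type*} {𝒜 : BooleanSubalgebra (Set S)} (C : Set (FAProb 𝒜 → EReal)) : Prop :=
  (⨆ c ∈ C, ⨅ p, c p) = 0

/-- `u : X → ℝ` is affine on the convex subset `X` of a vector space. -/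
def IsAffineOn {E : Type*} [AddCommGroup E] [Module ℝ E] {X : Set E} (u : X → ℝ) : Prop :=
  ∀ (x y z : X) (a : ℝ), 0 ≤ a → a ≤ 1 → (z : E) = a • (x : E) + (1 - a) • (y : E) →
    u z = a * u x + (1 - a) * u y

/-- The preference `R` (`R f g` means `f ≿ g`) is represented by
`f ↦ min_{p ∈ Δ} (∫ u(f) dp + c₀(p))`. -/
def VariationalRep {S Y : Type*} {𝒜 : BooleanSubalgebra (Set S)}
    (R : SimpleFn 𝒜 Y → SimpleFn 𝒜 Y → Prop) (u : Y → ℝ) (c₀ : FAProb 𝒜 → EReal) : Prop :=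
  ∀ f g, R f g ↔ minVal c₀ (g.comp u) ≤ minVal c₀ (f.comp u)

/-- `x` is a certainty equivalent of the act `f`: `x ∼ f`. -/
def IsCertaintyEquiv {S Y : Type*} {𝒜 : BooleanSubalgebra (Set S)}
    (R : SimpleFn 𝒜 Y → SimpleFn 𝒜 Y → Prop) (f : SimpleFn 𝒜 Y) (x : Y) : Prop :=
  R (SimpleFn.const 𝒜 x) f ∧ R f (SimpleFn.const 𝒜 x)

/-- `C ⊆ 𝒞` is grounded and `R` is represented by
`f ↦ max_{c ∈ C} min_{p ∈ Δ} (∫ u(f) dp + c(p))`, the maximum being attained. -/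
def MaxMinRep {S Y : Type*} {𝒜 : BooleanSubalgebra (Set S)}
    (R : SimpleFn 𝒜 Y → SimpleFn 𝒜 Y → Prop) (u : Y → ℝ) (C : Set (FAProb 𝒜 → EReal)) : Prop :=
  C ⊆ Penalties 𝒜 ∧ Grounded C ∧ ∃ V : SimpleFn 𝒜 Y → EReal,
    (∀ f, IsGreatest ((fun c => minVal c (f.comp u)) '' C) (V f)) ∧
      ∀ f g, R f g ↔ V g ≤ V f

/-- `B ⊆ 𝒞` is grounded and `R` is represented by
`f ↦ min_{b ∈ B} max_{q ∈ Δ} (∫ u(f) dq - b(q))`, the minimum being attained. -/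
def MinMaxRep {S Y : Type*} {𝒜 : BooleanSubalgebra (Set S)}
    (R : SimpleFn 𝒜 Y → SimpleFn 𝒜 Y → Prop) (u : Y → ℝ) (B : Set (FAProb 𝒜 → EReal)) : Prop :=
  B ⊆ Penalties 𝒜 ∧ Grounded B ∧ ∃ V : SimpleFn 𝒜 Y → EReal,
    (∀ f, IsLeast ((fun b => maxVal b (f.comp u)) '' B) (V f)) ∧
      ∀ f g, R f g ↔ V g ≤ V f

/-- `C* = {c ∈ 𝒞 | min_p (∫ u(f) dp + c(p)) ≤ u(x_f) for all acts f}`. -/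
def Cstar {S Y : Type*} {𝒜 : BooleanSubalgebra (Set S)}
    (R : SimpleFn 𝒜 Y → SimpleFn 𝒜 Y → Prop) (u : Y → ℝ) : Set (FAProb 𝒜 → EReal) :=
  {c ∈ Penalties 𝒜 | ∀ f x, IsCertaintyEquiv R f x → minVal c (f.comp u) ≤ ((u x : ℝ) : EReal)}

/-- `B* = {b ∈ 𝒞 | max_q (∫ u(f) dq - b(q)) ≥ u(x_f) for all acts f}`. -/
def Bstar {S Y : Type*} {𝒜 : BooleanSubalgebra (Set S)}
    (R : SimpleFn 𝒜 Y → SimpleFn 𝒜 Y → Prop) (u : Y → ℝ) : Set (FAProb 𝒜 → EReal) :=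
  {b ∈ Penalties 𝒜 | ∀ f x, IsCertaintyEquiv R f x → ((u x : ℝ) : EReal) ≤ maxVal b (f.comp u)}

/-- The `u`-equivalence of penalties: `min_p (∫ φ dp + c₁(p)) = min_p (∫ φ dp + c₂(p))` for all
`φ ∈ B₀(Σ, u(X))`. -/
def UEquiv {S Y : Type*} {𝒜 : BooleanSubalgebra (Set S)} (u : Y → ℝ)
    (c₁ c₂ : FAProb 𝒜 → EReal) : Prop :=
  ∀ φ : SimpleFn 𝒜 ℝ, (∀ s, φ.toFun s ∈ Set.range u) → minVal c₁ φ = minVal c₂ φ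

end NiveloidalPref

end

/-! Since `c₀` is grounded, `minVal c₀ φ` lies between the least and greatest values of `φ`, and the
range of `u` is an interval. So every act has a certainty equivalent, and membership in `Cstar` or
`Bstar` becomes `minVal c ≤ minVal c₀`, respectively `minVal c₀ ≤ maxVal b`, on utility-valued
functions (`mem_Cstar_iff`, `mem_Bstar_iff`).

In the max-min case `c₀` itself attains the value. In the min-max case, for an act with utility
profile `φ` and value `t`, the penalty `q ↦ ∫ φ dq - t` attains it
(`minVal_le_maxVal_affinePenalty`). Any other grounded representation is compared with `u x` at the
constant act of a certainty equivalent, which gives maximality.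

The explicit descriptions rest on `envelope`, the least penalty with prescribed lower bounds on its
values. For `Cstar` it is built from the values of `c`, for `Bstar` from those of `c₀`. The latter
case needs a minimax argument (`iInf_add_envelope_nonpos`): Hahn–Banach for finitely many functions,
then compactness of `Δ`. -/

namespace NiveloidalPref

open Filter Topology

variable {S : Type*} {𝒜 : BooleanSubalgebra (Set S)} {Y : Type*}

/-! ### Integration against finitely additive probabilities -/

/-- Finite additivity along the fibres of a simple function. -/
theorem FAProb.prob_preimage_finset (p : FAProb 𝒜) (Φ : SimpleFn 𝒜 Y) (t : Finset Y) :
    p.prob ⟨Φ.toFun ⁻¹' t, Φ.preimage_mem t⟩ =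
      ∑ y ∈ t, p.prob ⟨Φ.toFun ⁻¹' {y}, Φ.preimage_mem {y}⟩ := by
  classical
  induction t using Finset.induction_on with
  | empty =>
    have h := p.additive ⊥ ⊥ disjoint_bot_left
    rw [sup_bot_eq] at h
    have h' : (⟨Φ.toFun ⁻¹' ((∅ : Finset Y) : Set Y), Φ.preimage_mem _⟩ : 𝒜) = ⊥ :=
      Subtype.ext (by simp)
    rw [h', Finset.sum_empty]
    linarith
  | insert y t hy ih =>
    rw [Finset.sum_insert hy, ← ih, ← p.additive]
    · congr 1
      refine Subtype.ext ?_
      rw [BooleanSubalgebra.val_sup]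
      ext s
      simp
    · rw [disjoint_iff]
      refine Subtype.ext ?_
      rw [BooleanSubalgebra.val_inf]
      ext s
      simp only [Set.inf_eq_inter, Set.mem_inter_iff, Set.mem_preimage, Set.mem_singleton_iff,
        Finset.mem_coe, BooleanSubalgebra.val_bot, Set.bot_eq_empty, Set.mem_empty_iff_false,
        iff_false]
      rintro ⟨rfl, h⟩
      exact hy h

/-- Change of variables for the integral of a function of a simple function. -/
theorem FAProb.integral_comp (p : FAProb 𝒜) (Φ : SimpleFn 𝒜 Y) (g : Y → ℝ) :
    p.integral (Φ.comp g) = ∑ y ∈ Φ.finite_range.toFinset,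
      g y * p.prob ⟨Φ.toFun ⁻¹' {y}, Φ.preimage_mem {y}⟩ := by
  classical
  have hmaps : ∀ y ∈ Φ.finite_range.toFinset, g y ∈ (Φ.comp g).finite_range.toFinset := by
    intro y hy
    obtain ⟨s, rfl⟩ := (Set.Finite.mem_toFinset _).1 hy
    exact (Set.Finite.mem_toFinset _).2 ⟨s, rfl⟩
  rw [← Finset.sum_fiberwise_of_maps_to hmaps, FAProb.integral]
  refine Finset.sum_congr rfl fun r _ => ?_
  have : (⟨(Φ.comp g).toFun ⁻¹' {r}, (Φ.comp g).preimage_mem {r}⟩ : 𝒜) =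
      ⟨Φ.toFun ⁻¹' ((Φ.finite_range.toFinset.filter fun y => g y = r : Finset Y) : Set Y),
        Φ.preimage_mem _⟩ := by
    refine Subtype.ext ?_
    ext s
    simp [SimpleFn.comp]
  rw [this, p.prob_preimage_finset, Finset.mul_sum]
  refine Finset.sum_congr rfl fun y hy => ?_
  rw [(Finset.mem_filter.1 hy).2]

theorem FAProb.sum_prob (p : FAProb 𝒜) (Φ : SimpleFn 𝒜 Y) :
    ∑ y ∈ Φ.finite_range.toFinset, p.prob ⟨Φ.toFun ⁻¹' {y}, Φ.preimage_mem {y}⟩ = 1 := by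
  rw [← p.prob_preimage_finset, ← p.prob_univ]
  congr 1
  refine Subtype.ext ?_
  ext s
  simp

theorem FAProb.le_integral (p : FAProb 𝒜) {φ : SimpleFn 𝒜 ℝ} {m : ℝ}
    (h : ∀ s, m ≤ φ.toFun s) : m ≤ p.integral φ := by
  rw [FAProb.integral, ← mul_one m, ← p.sum_prob φ, Finset.mul_sum]
  refine Finset.sum_le_sum fun y hy => mul_le_mul_of_nonneg_right ?_ (p.nonneg _)
  obtain ⟨s, rfl⟩ := (Set.Finite.mem_toFinset _).1 hy
  exact h s

theorem FAProb.integral_le (p : FAProb 𝒜) {φ : SimpleFn 𝒜 ℝ} {m : ℝ}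
    (h : ∀ s, φ.toFun s ≤ m) : p.integral φ ≤ m := by
  rw [FAProb.integral, ← mul_one m, ← p.sum_prob φ, Finset.mul_sum]
  refine Finset.sum_le_sum fun y hy => mul_le_mul_of_nonneg_right ?_ (p.nonneg _)
  obtain ⟨s, rfl⟩ := (Set.Finite.mem_toFinset _).1 hy
  exact h s

theorem FAProb.integral_const (p : FAProb 𝒜) (t : ℝ) :
    p.integral (SimpleFn.const 𝒜 t) = t :=
  le_antisymm (p.integral_le fun _ => le_rfl) (p.le_integral fun _ => le_rfl)

theorem FAProb.integral_mix {a : ℝ} (h0 : 0 ≤ a) (h1 : a ≤ 1) (p q : FAProb 𝒜)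
    (φ : SimpleFn 𝒜 ℝ) :
    (FAProb.mix a h0 h1 p q).integral φ = a * p.integral φ + (1 - a) * q.integral φ := by
  simp only [FAProb.integral, FAProb.mix, Finset.mul_sum, ← Finset.sum_add_distrib]
  exact Finset.sum_congr rfl fun _ _ => by ring

/-- A finite tuple of simple functions, as a simple function with values in tuples. -/
def SimpleFn.pi {ι : Type*} [Finite ι] (φ : ι → SimpleFn 𝒜 Y) : SimpleFn 𝒜 (ι → Y) where
  toFun := fun s i => (φ i).toFun s
  finite_range := (Set.Finite.pi' fun i => (φ i).finite_range).subset (by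
    rintro _ ⟨s, rfl⟩ i
    exact ⟨s, rfl⟩)
  preimage_mem := by
    classical
    have := Fintype.ofFinite ι
    intro B
    have hfin : (Set.range fun s i => (φ i).toFun s).Finite :=
      (Set.Finite.pi' fun i => (φ i).finite_range).subset (by
        rintro _ ⟨s, rfl⟩ i
        exact ⟨s, rfl⟩)
    have hmem : (hfin.toFinset.filter (· ∈ B)).sup
        (fun y => Finset.univ.inf fun i => (φ i).toFun ⁻¹' {y i}) ∈ 𝒜 := by
      refine Finset.sup_induction BooleanSubalgebra.bot_mem
        (fun a ha b hb => BooleanSubalgebra.sup_mem ha hb) fun y _ => ?_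
      exact Finset.inf_induction BooleanSubalgebra.top_mem
        (fun a ha b hb => BooleanSubalgebra.inf_mem ha hb) fun i _ => (φ i).preimage_mem _
    convert hmem using 1
    ext s
    simp only [Set.mem_preimage, Finset.sup_eq_iSup, Finset.inf_eq_iInf, Set.iSup_eq_iUnion,
      Set.iInf_eq_iInter, Set.mem_iUnion, Set.mem_iInter, Finset.mem_filter,
      Set.Finite.mem_toFinset, Set.mem_singleton_iff, exists_prop, Finset.mem_univ, true_implies]
    constructor
    · exact fun h => ⟨_, ⟨⟨s, rfl⟩, h⟩, fun i => rfl⟩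
    · rintro ⟨y, ⟨-, hy⟩, h⟩
      rwa [show (fun i => (φ i).toFun s) = y from funext h]

/-- The linear combination `∑ i, w i • φ i`. -/
def SimpleFn.linComb {ι : Type*} [Fintype ι] (w : ι → ℝ) (φ : ι → SimpleFn 𝒜 ℝ) :
    SimpleFn 𝒜 ℝ :=
  (SimpleFn.pi φ).comp fun y => ∑ i, w i * y i

theorem FAProb.integral_linComb {ι : Type*} [Fintype ι] (p : FAProb 𝒜) (w : ι → ℝ)
    (φ : ι → SimpleFn 𝒜 ℝ) :
    p.integral (SimpleFn.linComb w φ) = ∑ i, w i * p.integral (φ i) := by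
  have h : ∀ i, p.integral (φ i) = _ := fun i =>
    p.integral_comp (SimpleFn.pi φ) fun y : ι → ℝ => y i
  simp only [h, SimpleFn.linComb, FAProb.integral_comp, Finset.mul_sum, Finset.sum_mul]
  rw [Finset.sum_comm]
  simp only [mul_assoc]

/-! ### The weak* topology and compactness of `Δ` -/

theorem FAProb.continuous_integral (φ : SimpleFn 𝒜 ℝ) :
    Continuous fun p : FAProb 𝒜 => p.integral φ :=
  continuous_iff_le_induced.2 (iInf_le _ φ)

theorem FAProb.prob_le_one (p : FAProb 𝒜) (A : 𝒜) : p.prob A ≤ 1 := by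
  have h := p.additive A Aᶜ disjoint_compl_right
  rw [sup_compl_eq_top, p.prob_univ] at h
  linarith [p.nonneg Aᶜ]

/-- Along an ultrafilter each `p.prob A` converges in `[0, 1]`. The limits again form a finitely
additive probability, and an integral is a finite combination of such values, so setwise convergence
is weak* convergence. -/
instance FAProb.instCompactSpace : CompactSpace (FAProb 𝒜) where
  isCompact_univ := by
    rw [isCompact_iff_ultrafilter_le_nhds]
    intro F _
    have hlim : ∀ A : 𝒜, ∃ r : ℝ, Tendsto (fun p : FAProb 𝒜 => p.prob A) F (𝓝 r) := by
      intro A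
      obtain ⟨r, -, hr⟩ := isCompact_iff_ultrafilter_le_nhds.1
        (isCompact_Icc (a := (0 : ℝ)) (b := 1))
        (F.map fun p : FAProb 𝒜 => p.prob A) (by
          rw [Ultrafilter.coe_map, le_principal_iff, mem_map]
          exact Filter.univ_mem' fun p => ⟨p.nonneg A, p.prob_le_one A⟩)
      exact ⟨r, hr⟩
    choose r hr using hlim
    let q : FAProb 𝒜 :=
      { prob := r
        nonneg := fun A => ge_of_tendsto' (hr A) fun p => p.nonneg A
        prob_univ := tendsto_nhds_unique (hr ⊤) (by simp only [FAProb.prob_univ]; exact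
          tendsto_const_nhds)
        additive := fun A B h => tendsto_nhds_unique (hr _) (by
          simp only [FAProb.additive _ A B h]
          exact (hr A).add (hr B)) }
    refine ⟨q, Set.mem_univ _, ?_⟩
    rw [nhds_iInf]
    refine le_iInf fun φ => ?_
    rw [nhds_induced, ← tendsto_iff_comap]
    exact tendsto_finsetSum _ fun x _ => (hr _).const_mul x

/-! ### Extended-real calculus of `minVal` and `maxVal` -/

theorem coe_le_minVal_iff {c : FAProb 𝒜 → EReal} (hc : ∀ p, c p ≠ ⊥) {φ : SimpleFn 𝒜 ℝ} {t : ℝ} :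
    (t : EReal) ≤ minVal c φ ↔ ∀ (p : FAProb 𝒜) (r : ℝ), c p = r → t ≤ p.integral φ + r := by
  rw [minVal, le_iInf_iff]
  refine forall_congr' fun p => ?_
  induction h : c p with
  | bot => exact absurd h (hc p)
  | top => simp
  | coe x =>
    rw [← EReal.coe_add, EReal.coe_le_coe_iff]
    refine ⟨fun hx r hr => ?_, fun hx => hx x rfl⟩
    rwa [← EReal.coe_injective hr]

theorem coe_lt_maxVal_iff {b : FAProb 𝒜 → EReal} (hb : ∀ p, b p ≠ ⊥) {φ : SimpleFn 𝒜 ℝ} {t : ℝ} :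
    (t : EReal) < maxVal b φ ↔ ∃ (p : FAProb 𝒜) (r : ℝ), b p = r ∧ t < p.integral φ - r := by
  rw [maxVal, lt_iSup_iff]
  refine exists_congr fun p => ?_
  induction h : b p with
  | bot => exact absurd h (hb p)
  | top => simp
  | coe x =>
    rw [← EReal.coe_sub, EReal.coe_lt_coe_iff]
    refine ⟨fun hx => ⟨x, rfl, hx⟩, ?_⟩
    rintro ⟨r, hr, hx⟩
    rwa [EReal.coe_injective hr]

theorem le_maxVal {b : FAProb 𝒜 → EReal} {φ : SimpleFn 𝒜 ℝ} {p : FAProb 𝒜} {r : ℝ}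
    (h : b p = r) : ((p.integral φ - r : ℝ) : EReal) ≤ maxVal b φ :=
  le_iSup_of_le p (by rw [h, EReal.coe_sub])

theorem minVal_mono {c c' : FAProb 𝒜 → EReal} (h : c ≤ c') (φ : SimpleFn 𝒜 ℝ) :
    minVal c φ ≤ minVal c' φ :=
  iInf_mono fun p => add_le_add_right (h p) _

theorem minVal_const (c : FAProb 𝒜 → EReal) (t : ℝ) :
    minVal c (SimpleFn.const 𝒜 t) = t + ⨅ p, c p := by
  simp only [minVal, FAProb.integral_const]
  refine (Monotone.map_iInf_of_continuousAt (f := fun x : EReal => (t : EReal) + x) ?_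
    (fun x y h => add_le_add_right h _) (EReal.coe_add_top t)).symm
  exact (EReal.continuousAt_add (p := ((t : EReal), iInf c)) (.inl (EReal.coe_ne_top t))
    (.inl (EReal.coe_ne_bot t))).comp (by fun_prop)

theorem maxVal_const (b : FAProb 𝒜 → EReal) (t : ℝ) :
    maxVal b (SimpleFn.const 𝒜 t) = t - ⨅ p, b p := by
  simp only [maxVal, FAProb.integral_const]
  refine (Antitone.map_iInf_of_continuousAt (f := fun x : EReal => (t : EReal) - x) ?_
    (fun x y h => EReal.sub_le_sub le_rfl h) (by simp)).symm
  have := (EReal.continuousAt_add (p := ((t : EReal), -iInf b)) (.inl (EReal.coe_ne_top t))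
    (.inl (EReal.coe_ne_bot t))).comp
    (f := fun x : EReal => ((t : EReal), -x)) (x := iInf b)
    (by fun_prop)
  exact this

theorem coe_add_le_coe_iff {t : ℝ} {x : EReal} : (t : EReal) + x ≤ t ↔ x ≤ 0 := by
  induction x with
  | bot => simp
  | top => simp
  | coe x => norm_cast; constructor <;> intro h <;> linarith

theorem coe_le_coe_sub_iff {t : ℝ} {x : EReal} : (t : EReal) ≤ t - x ↔ x ≤ 0 := by
  induction x with
  | bot => simp
  | top => simp
  | coe x => norm_cast; constructor <;> intro h <;> linarith

theorem SimpleFn.exists_bounds (φ : SimpleFn 𝒜 ℝ) :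
    ∃ m M, ∀ s, m ≤ φ.toFun s ∧ φ.toFun s ≤ M := by
  obtain ⟨m, hm⟩ := φ.finite_range.bddBelow
  obtain ⟨M, hM⟩ := φ.finite_range.bddAbove
  exact ⟨m, M, fun s => ⟨hm ⟨s, rfl⟩, hM ⟨s, rfl⟩⟩⟩

theorem minVal_ne_bot {c : FAProb 𝒜 → EReal} (hc : c ∈ Penalties 𝒜) (φ : SimpleFn 𝒜 ℝ) :
    minVal c φ ≠ ⊥ := by
  obtain hΔ | hΔ := isEmpty_or_nonempty (FAProb 𝒜)
  · rw [minVal, iInf_of_empty]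
    exact bot_ne_top.symm
  obtain ⟨p₀, -, hp₀⟩ := (hc.2.1.lowerSemicontinuousOn Set.univ).exists_isMinOn Set.univ_nonempty
    isCompact_univ
  obtain ⟨m, M, hφ⟩ := φ.exists_bounds
  -- If `c p₀ = ⊤`, then `toReal` gives `0`, which is still below the minimum of `c`.
  have key : ((m + (c p₀).toReal : ℝ) : EReal) ≤ minVal c φ := by
    refine (coe_le_minVal_iff hc.1).2 fun p r hr => ?_
    have h1 : c p₀ ≤ c p := hp₀ (Set.mem_univ p)
    have h2 := (EReal.coe_toReal_le (hc.1 p₀)).trans (h1.trans_eq hr)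
    exact add_le_add (p.le_integral fun s => (hφ s).1) (EReal.coe_le_coe_iff.1 h2)
  exact ne_bot_of_le_ne_bot (EReal.coe_ne_bot _) key

/-! ### Envelopes of prescribed values -/

/-- The least penalty whose value at every `φ ∈ D` is at least `v φ`. -/
noncomputable def envelope (D : Set (SimpleFn 𝒜 ℝ)) (v : SimpleFn 𝒜 ℝ → ℝ) (p : FAProb 𝒜) :
    EReal :=
  ⨆ φ ∈ D, ((v φ - p.integral φ : ℝ) : EReal)

theorem continuous_coe_sub_integral (φ : SimpleFn 𝒜 ℝ) (t : ℝ) :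
    Continuous fun p : FAProb 𝒜 => ((t - p.integral φ : ℝ) : EReal) :=
  continuous_coe_real_ereal.comp (continuous_const.sub (FAProb.continuous_integral φ))

theorem envelope_mem_penalties {D : Set (SimpleFn 𝒜 ℝ)} (hD : D.Nonempty)
    (v : SimpleFn 𝒜 ℝ → ℝ) : envelope D v ∈ Penalties 𝒜 := by
  refine ⟨fun p => ?_, ?_, fun p q a h0 h1 => ?_⟩
  · obtain ⟨φ, hφ⟩ := hD
    exact ne_bot_of_le_ne_bot (EReal.coe_ne_bot (v φ - p.integral φ))
      (le_iSup₂ (f := fun φ (_ : φ ∈ D) => ((v φ - p.integral φ : ℝ) : EReal)) φ hφ)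
  · exact lowerSemicontinuous_iSup fun φ => lowerSemicontinuous_iSup fun _ =>
      (continuous_coe_sub_integral φ (v φ)).lowerSemicontinuous
  · refine iSup₂_le fun φ hφ => ?_
    have hle : ∀ p : FAProb 𝒜, ((v φ - p.integral φ : ℝ) : EReal) ≤ envelope D v p := fun p =>
      le_iSup₂ (f := fun φ (_ : φ ∈ D) => ((v φ - p.integral φ : ℝ) : EReal)) φ hφ
    calc ((v φ - (FAProb.mix a h0.le h1.le p q).integral φ : ℝ) : EReal)
        = (a : EReal) * ((v φ - p.integral φ : ℝ) : EReal) +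
            ((1 - a : ℝ) : EReal) * ((v φ - q.integral φ : ℝ) : EReal) := by
          rw [FAProb.integral_mix, ← EReal.coe_mul, ← EReal.coe_mul, ← EReal.coe_add]
          congr 1
          ring
      _ ≤ _ := add_le_add
          (mul_le_mul_of_nonneg_left (hle p) (EReal.coe_nonneg.2 h0.le))
          (mul_le_mul_of_nonneg_left (hle q) (EReal.coe_nonneg.2 (sub_nonneg.2 h1.le)))

theorem envelope_le {D : Set (SimpleFn 𝒜 ℝ)} {v : SimpleFn 𝒜 ℝ → ℝ} {c : FAProb 𝒜 → EReal}
    (hc : ∀ p, c p ≠ ⊥) (h : ∀ φ ∈ D, (v φ : EReal) ≤ minVal c φ) : envelope D v ≤ c := by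
  intro p
  refine iSup₂_le fun φ hφ => ?_
  have := (coe_le_minVal_iff hc).1 (h φ hφ) p
  induction hp : c p with
  | bot => exact absurd hp (hc p)
  | top => exact le_top
  | coe r => exact EReal.coe_le_coe_iff.2 (by linarith [this r hp])

theorem le_minVal_envelope {D : Set (SimpleFn 𝒜 ℝ)} {v : SimpleFn 𝒜 ℝ → ℝ} {φ : SimpleFn 𝒜 ℝ}
    (hφ : φ ∈ D) : (v φ : EReal) ≤ minVal (envelope D v) φ := by
  refine (coe_le_minVal_iff (envelope_mem_penalties ⟨φ, hφ⟩ v).1).2 fun p r hr => ?_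
  have : ((v φ - p.integral φ : ℝ) : EReal) ≤ r :=
    (le_iSup₂ (f := fun φ (_ : φ ∈ D) => ((v φ - p.integral φ : ℝ) : EReal)) φ hφ).trans_eq hr
  linarith [EReal.coe_le_coe_iff.1 this]

/-- The envelope of the values of `c` lies below `c` by minimality, while each of its values is
bounded below by the prescribed one. -/
theorem minVal_envelope {D : Set (SimpleFn 𝒜 ℝ)} {v : SimpleFn 𝒜 ℝ → ℝ} {c : FAProb 𝒜 → EReal}
    (hc : ∀ p, c p ≠ ⊥) (h : ∀ φ ∈ D, minVal c φ = v φ) {φ : SimpleFn 𝒜 ℝ} (hφ : φ ∈ D) :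
    minVal (envelope D v) φ = minVal c φ :=
  le_antisymm (minVal_mono (envelope_le hc fun φ hφ => (h φ hφ).ge) φ)
    ((h φ hφ).trans_le (le_minVal_envelope hφ))

/-! ### The minimax argument -/

/-- A convex set that meets every weighted-average half-space `∑ w i * y i < δ` contains a point
all of whose coordinates are at most `δ`. -/
theorem exists_mem_forall_le_of_stdSimplex {ι : Type*} [Fintype ι] {K : Set (ι → ℝ)}
    (hK : Convex ℝ K) (hne : K.Nonempty) {δ : ℝ}
    (h : ∀ w ∈ stdSimplex ℝ ι, ∃ y ∈ K, ∑ i, w i * y i < δ) : ∃ y ∈ K, ∀ i, y i ≤ δ := by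
  classical
  by_contra! hcon
  have hUconv : Convex ℝ {y : ι → ℝ | ∀ i, y i < δ} := by
    intro x hx y hy a b ha hb hab i
    exact (convex_Iio δ) (hx i) (hy i) ha hb hab
  have hUopen : IsOpen {y : ι → ℝ | ∀ i, y i < δ} := by
    simp only [Set.ofPred_forall]
    exact isOpen_iInter_of_finite fun i => isOpen_lt (continuous_apply i) continuous_const
  obtain ⟨f, s, hfU, hfK⟩ := geometric_hahn_banach_open hUconv hUopen hK
    (Set.disjoint_left.2 fun y hyU hyK => by
      obtain ⟨i, hi⟩ := hcon y hyK
      exact (hyU i).not_gt hi)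
  set w : ι → ℝ := fun i => f (Pi.single i 1) with hw
  have hf : ∀ y, f y = ∑ i, w i * y i := by
    intro y
    conv_lhs => rw [pi_eq_sum_univ' y]
    rw [map_sum]
    refine Finset.sum_congr rfl fun i _ => ?_
    rw [map_smul, smul_eq_mul, mul_comm]
  obtain ⟨y₀, hy₀⟩ := hne
  -- The open set is closed downwards: moving along `-Pi.single i 1` with `w i < 0` would raise `f`
  -- up to the bound `s`.
  have hw0 : ∀ i, 0 ≤ w i := by
    intro i
    by_contra! hi
    have hk : ∀ k : ℝ, 0 ≤ k → (∑ j, w j * (δ - 1)) - k * w i < s := by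
      intro k hk
      have := hfU ((fun _ => δ - 1) - k • Pi.single i 1) (fun j => by
        have : 0 ≤ k * (Pi.single i 1 : ι → ℝ) j := by
          refine mul_nonneg hk ?_
          by_cases hj : j = i
          · subst hj; simp
          · simp [hj]
        simp only [Pi.sub_apply, Pi.smul_apply, smul_eq_mul]
        linarith)
      rw [map_sub, map_smul, hf fun _ => δ - 1] at this
      exact this
    have h0 := hk 0 le_rfl
    have h1 := hk ((s - ∑ j, w j * (δ - 1)) / (-w i))
      (div_nonneg (by linarith) (by linarith))
    have : (s - ∑ j, w j * (δ - 1)) / (-w i) * w i = -(s - ∑ j, w j * (δ - 1)) := by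
      rw [div_neg, neg_mul, div_mul_cancel₀ _ hi.ne]
    linarith
  have hWpos : 0 < ∑ i, w i := by
    refine lt_of_le_of_ne (Finset.sum_nonneg fun i _ => hw0 i) fun h0 => ?_
    have hz : ∀ i, w i = 0 := fun i =>
      (Finset.sum_eq_zero_iff_of_nonneg fun i _ => hw0 i).1 h0.symm i (Finset.mem_univ i)
    have h1 := hfU (fun _ => δ - 1) (fun i => by linarith)
    have h2 := hfK y₀ hy₀
    simp only [hf, hz, zero_mul, Finset.sum_const_zero] at h1 h2
    linarith
  obtain ⟨y, hy, hlt⟩ := h (fun i => w i / ∑ j, w j)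
    ⟨fun i => div_nonneg (hw0 i) hWpos.le, by rw [← Finset.sum_div, div_self hWpos.ne']⟩
  have hlt' : f y < δ * ∑ i, w i := by
    rw [hf, ← div_lt_iff₀ hWpos, Finset.sum_div]
    refine lt_of_eq_of_lt (Finset.sum_congr rfl fun i _ => ?_) hlt
    ring
  have hs := hfK y hy
  -- The constant vector on which `f` equals exactly `s`; lying in the open set, it forces `s < s`.
  have := hfU (fun _ => δ - (δ * ∑ i, w i - s) / ∑ i, w i) (fun i => by
    have : 0 < (δ * ∑ i, w i - s) / ∑ i, w i := div_pos (by linarith) hWpos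
    linarith)
  rw [hf, ← Finset.sum_mul, mul_sub, mul_div_cancel₀ _ hWpos.ne'] at this
  linarith

/-- The minimax step: if `maxVal b` dominates a concave functional `v` on a convex set `D` of
simple functions, then `b + envelope D v` has nonpositive infimum. -/
theorem iInf_add_envelope_nonpos {b : FAProb 𝒜 → EReal} (hb : b ∈ Penalties 𝒜)
    {D : Set (SimpleFn 𝒜 ℝ)} (hne : D.Nonempty) {v : SimpleFn 𝒜 ℝ → ℝ}
    (hD : ∀ t : Finset D, ∀ w ∈ stdSimplex ℝ t, SimpleFn.linComb w (fun i => i.1.1) ∈ D)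
    (hv : ∀ t : Finset D, ∀ w ∈ stdSimplex ℝ t,
      ∑ i, w i * v i.1.1 ≤ v (SimpleFn.linComb w (fun i => i.1.1)))
    (hbv : ∀ φ ∈ D, (v φ : EReal) ≤ maxVal b φ) :
    (⨅ p, b p + envelope D v p) ≤ 0 := by
  have hlt : ∀ ε : ℝ, 0 < ε → ∀ φ ∈ D,
      ∃ (p : FAProb 𝒜) (r : ℝ), b p = r ∧ v φ - ε < p.integral φ - r := by
    intro ε hε φ hφ
    refine (coe_lt_maxVal_iff hb.1).1 (lt_of_lt_of_le ?_ (hbv φ hφ))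
    exact EReal.coe_lt_coe_iff.2 (by linarith)
  have hfin : ∀ ε : ℝ, 0 < ε → ∀ t : Finset D, ∃ (p : FAProb 𝒜) (r : ℝ), b p = r ∧
      ∀ i ∈ t, r + (v i - p.integral i) ≤ ε := by
    intro ε hε t
    -- `K` is the upward closure of the achievable vectors `r + (v i - ∫ i dp)` with `r = b p`;
    -- passing to the upward closure makes it convex, as `b` is convex.
    have hK := exists_mem_forall_le_of_stdSimplex
      (K := {y : t → ℝ | ∃ (p : FAProb 𝒜) (r : ℝ), b p = r ∧
        ∀ i : t, r + (v i.1.1 - p.integral i.1.1) ≤ y i}) (δ := ε) ?_ ?_ ?_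
    · obtain ⟨y, ⟨p, r, hr, hy⟩, hle⟩ := hK
      exact ⟨p, r, hr, fun i hi => (hy ⟨i, hi⟩).trans (hle ⟨i, hi⟩)⟩
    · refine convex_iff_forall_pos.2 ?_
      rintro y ⟨p, r, hr, hy⟩ y' ⟨p', r', hr', hy'⟩ a a' ha ha' haa
      obtain rfl : a' = 1 - a := by linarith
      have hmix := hb.2.2 p p' a ha (by linarith)
      rw [hr, hr', ← EReal.coe_mul, ← EReal.coe_mul, ← EReal.coe_add] at hmix
      set q := FAProb.mix a ha.le (by linarith) p p' with hq
      refine ⟨q, (b q).toReal, (EReal.coe_toReal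
        (ne_top_of_le_ne_top (EReal.coe_ne_top _) hmix) (hb.1 q)).symm, fun i => ?_⟩
      have h1 : (b q).toReal ≤ a * r + (1 - a) * r' :=
        EReal.coe_le_coe_iff.1 ((EReal.coe_toReal_le (hb.1 q)).trans hmix)
      rw [hq, FAProb.integral_mix, ← hq]
      simp only [Pi.add_apply, Pi.smul_apply, smul_eq_mul]
      linarith [mul_le_mul_of_nonneg_left (hy i) ha.le,
        mul_le_mul_of_nonneg_left (hy' i) ha'.le]
    · obtain ⟨φ, hφ⟩ := hne
      obtain ⟨p, r, hr, -⟩ := hlt 1 one_pos φ hφ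
      exact ⟨_, p, r, hr, fun i => le_rfl⟩
    -- Concavity of `v` reduces a weighted average over `t` to the single function `linComb w`,
    -- which is in `D`.
    · intro w hw
      obtain ⟨p, r, hr, hp⟩ := hlt ε hε _ (hD t w hw)
      refine ⟨fun i => r + (v i.1.1 - p.integral i.1.1), ⟨p, r, hr, fun i => le_rfl⟩, ?_⟩
      have hconc := hv t w hw
      rw [FAProb.integral_linComb] at hp
      simp only [mul_add, mul_sub, Finset.sum_add_distrib, Finset.sum_sub_distrib,
        ← Finset.sum_mul, hw.2]
      linarith
  refine EReal.le_of_forall_lt_iff_le.1 fun ε hε => ?_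
  have hε' : 0 < ε := EReal.coe_pos.1 hε
  -- Closed sublevel sets with the finite intersection property: compactness gives one `p` serving
  -- all of `D`.
  let Z : D → Set (FAProb 𝒜) := fun φ =>
    (fun p => b p + ((v φ - p.integral φ : ℝ) : EReal)) ⁻¹' Set.Iic (ε : EReal)
  have hZclosed : ∀ φ, IsClosed (Z φ) := fun φ =>
    (hb.2.1.add' (continuous_coe_sub_integral φ.1 (v φ)).lowerSemicontinuous fun p =>
      EReal.continuousAt_add (.inr (EReal.coe_ne_bot _))
        (.inr (EReal.coe_ne_top _))).isClosed_preimage _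
  obtain ⟨p, hp⟩ := CompactSpace.iInter_nonempty hZclosed fun t => by
    obtain ⟨p, r, hr, hp⟩ := hfin ε hε' t
    refine ⟨p, Set.mem_iInter₂.2 fun i hi => ?_⟩
    change b p + _ ≤ (ε : EReal)
    rw [hr, ← EReal.coe_add]
    exact EReal.coe_le_coe_iff.2 (hp i hi)
  have hp' : ∀ φ ∈ D, b p + ((v φ - p.integral φ : ℝ) : EReal) ≤ ε := fun φ hφ =>
    Set.mem_iInter.1 hp ⟨φ, hφ⟩
  refine (iInf_le _ p).trans ?_
  induction hr : b p with
  | bot => exact absurd hr (hb.1 p)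
  | top =>
    obtain ⟨φ, hφ⟩ := hne
    have := hp' φ hφ
    rw [hr, EReal.top_add_coe] at this
    exact absurd (top_le_iff.1 this) (EReal.coe_ne_top ε)
  | coe r =>
    have : envelope D v p ≤ ((ε - r : ℝ) : EReal) := iSup₂_le fun φ hφ => by
      have h := hp' φ hφ
      rw [hr, ← EReal.coe_add, EReal.coe_le_coe_iff] at h
      exact EReal.coe_le_coe_iff.2 (by linarith)
    refine (add_le_add_right this _).trans ?_
    rw [← EReal.coe_add, EReal.coe_le_coe_iff]
    linarith

/-! ### Utility-valued functions and certainty equivalents -/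

theorem IsAffineOn.convex_range {E : Type*} [AddCommGroup E] [Module ℝ E] {X : Set E}
    (hX : Convex ℝ X) {u : X → ℝ} (hu : IsAffineOn u) : Convex ℝ (Set.range u) := by
  rintro _ ⟨x, rfl⟩ _ ⟨y, rfl⟩ a b ha hb hab
  obtain rfl : b = 1 - a := by linarith
  exact ⟨⟨a • (x : E) + (1 - a) • (y : E), hX x.2 y.2 ha hb hab⟩,
    hu x y _ a ha (by linarith) rfl⟩

/-- The set `B₀(Σ, u(Y))`. -/
def utilityActs (𝒜 : BooleanSubalgebra (Set S)) (u : Y → ℝ) : Set (SimpleFn 𝒜 ℝ) :=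
  {φ | ∀ s, φ.toFun s ∈ Set.range u}

theorem comp_mem_utilityActs (u : Y → ℝ) (f : SimpleFn 𝒜 Y) : f.comp u ∈ utilityActs 𝒜 u :=
  fun s => ⟨f.toFun s, rfl⟩

theorem exists_comp_eq [Nonempty S] {u : Y → ℝ} {φ : SimpleFn 𝒜 ℝ} (hφ : φ ∈ utilityActs 𝒜 u) :
    ∃ f : SimpleFn 𝒜 Y, f.comp u = φ := by
  obtain ⟨s₀⟩ := ‹Nonempty S›
  have : Nonempty Y := ⟨(hφ s₀).choose⟩
  refine ⟨φ.comp (Function.invFun u), ?_⟩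
  obtain ⟨F, h1, h2⟩ := φ
  simp only [SimpleFn.comp, SimpleFn.mk.injEq]
  funext s
  exact Function.invFun_eq (hφ s)

theorem le_minVal_of_le {c : FAProb 𝒜 → EReal} (hc : (⨅ p, c p) = 0) {φ : SimpleFn 𝒜 ℝ} {m : ℝ}
    (h : ∀ s, m ≤ φ.toFun s) : (m : EReal) ≤ minVal c φ := by
  calc (m : EReal) = minVal c (SimpleFn.const 𝒜 m) := by rw [minVal_const, hc, add_zero]
    _ ≤ minVal c φ := iInf_mono fun p => by
      rw [FAProb.integral_const]
      exact add_le_add_left (EReal.coe_le_coe_iff.2 (p.le_integral h)) _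

theorem minVal_le_of_le {c : FAProb 𝒜 → EReal} (hc : (⨅ p, c p) = 0) {φ : SimpleFn 𝒜 ℝ} {m : ℝ}
    (h : ∀ s, φ.toFun s ≤ m) : minVal c φ ≤ m := by
  calc minVal c φ ≤ minVal c (SimpleFn.const 𝒜 m) := iInf_mono fun p => by
        rw [FAProb.integral_const]
        exact add_le_add_left (EReal.coe_le_coe_iff.2 (p.integral_le h)) _
    _ = m := by rw [minVal_const, hc, add_zero]

theorem exists_minVal_eq [Nonempty S] {u : Y → ℝ} (hu : Convex ℝ (Set.range u))
    {c : FAProb 𝒜 → EReal} (hc : (⨅ p, c p) = 0) {φ : SimpleFn 𝒜 ℝ} (hφ : φ ∈ utilityActs 𝒜 u) :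
    ∃ y, minVal c φ = (u y : EReal) := by
  obtain ⟨_, ⟨s, rfl⟩, hs⟩ := Set.exists_min_image _ id φ.finite_range (Set.range_nonempty _)
  obtain ⟨_, ⟨t, rfl⟩, ht⟩ := Set.exists_max_image _ id φ.finite_range (Set.range_nonempty _)
  have h1 := le_minVal_of_le hc (φ := φ) fun r => hs _ ⟨r, rfl⟩
  have h2 := minVal_le_of_le hc (φ := φ) fun r => ht _ ⟨r, rfl⟩
  lift minVal c φ to ℝ using ⟨ne_top_of_le_ne_top (EReal.coe_ne_top _) h2,
    ne_bot_of_le_ne_bot (EReal.coe_ne_bot _) h1⟩ with r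
  obtain ⟨y, hy⟩ := hu.ordConnected.out (hφ s) (hφ t)
    ⟨EReal.coe_le_coe_iff.1 h1, EReal.coe_le_coe_iff.1 h2⟩
  exact ⟨y, by rw [hy]⟩

theorem linComb_mem_utilityActs {u : Y → ℝ} (hu : Convex ℝ (Set.range u)) {ι : Type*} [Fintype ι]
    {w : ι → ℝ} (hw : w ∈ stdSimplex ℝ ι) {φ : ι → SimpleFn 𝒜 ℝ}
    (hφ : ∀ i, φ i ∈ utilityActs 𝒜 u) : SimpleFn.linComb w φ ∈ utilityActs 𝒜 u := fun s =>
  hu.sum_mem (t := Finset.univ) (fun i _ => hw.1 i) hw.2 fun i _ => hφ i s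

theorem sum_le_minVal_linComb {c : FAProb 𝒜 → EReal} (hc : ∀ p, c p ≠ ⊥) {ι : Type*} [Fintype ι]
    {w : ι → ℝ} (hw : w ∈ stdSimplex ℝ ι) {φ : ι → SimpleFn 𝒜 ℝ} {v : ι → ℝ}
    (hv : ∀ i, (v i : EReal) ≤ minVal c (φ i)) :
    ((∑ i, w i * v i : ℝ) : EReal) ≤ minVal c (SimpleFn.linComb w φ) := by
  refine (coe_le_minVal_iff hc).2 fun p r hr => ?_
  rw [FAProb.integral_linComb, ← one_mul r, ← hw.2, Finset.sum_mul, ← Finset.sum_add_distrib]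
  refine Finset.sum_le_sum fun i _ => ?_
  rw [← mul_add]
  exact mul_le_mul_of_nonneg_left ((coe_le_minVal_iff hc).1 (hv i) p r hr) (hw.1 i)

theorem isCertaintyEquiv_iff {R : SimpleFn 𝒜 Y → SimpleFn 𝒜 Y → Prop} {u : Y → ℝ}
    {c₀ : FAProb 𝒜 → EReal} (hc : (⨅ p, c₀ p) = 0) (hR : VariationalRep R u c₀)
    {f : SimpleFn 𝒜 Y} {x : Y} : IsCertaintyEquiv R f x ↔ minVal c₀ (f.comp u) = u x := by
  have : minVal c₀ ((SimpleFn.const 𝒜 x).comp u) = u x := by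
    change minVal c₀ (SimpleFn.const 𝒜 (u x)) = u x
    rw [minVal_const, hc, add_zero]
  rw [IsCertaintyEquiv, hR, hR, this, le_antisymm_iff]

/-! ### The greatest max-min representation -/

section Preference

variable {R : SimpleFn 𝒜 Y → SimpleFn 𝒜 Y → Prop} {u : Y → ℝ}
  {c₀ : FAProb 𝒜 → EReal}

/-- Every utility-valued function comes from an act, and that act has a certainty equivalent, so the
defining condition is never vacuous. -/
theorem mem_Cstar_iff [Nonempty S] (hu : Convex ℝ (Set.range u)) (hc : (⨅ p, c₀ p) = 0)
    (hR : VariationalRep R u c₀) {c : FAProb 𝒜 → EReal} :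
    c ∈ Cstar R u ↔ c ∈ Penalties 𝒜 ∧ ∀ φ ∈ utilityActs 𝒜 u, minVal c φ ≤ minVal c₀ φ := by
  refine and_congr_right fun _ => ⟨fun h φ hφ => ?_, fun h f x hx => ?_⟩
  · obtain ⟨f, rfl⟩ := exists_comp_eq hφ
    obtain ⟨x, hx⟩ := exists_minVal_eq hu hc hφ
    exact (h f x ((isCertaintyEquiv_iff hc hR).2 hx)).trans_eq hx.symm
  · exact (h _ (comp_mem_utilityActs u f)).trans_eq ((isCertaintyEquiv_iff hc hR).1 hx)

theorem mem_Bstar_iff [Nonempty S] (hu : Convex ℝ (Set.range u)) (hc : (⨅ p, c₀ p) = 0)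
    (hR : VariationalRep R u c₀) {b : FAProb 𝒜 → EReal} :
    b ∈ Bstar R u ↔ b ∈ Penalties 𝒜 ∧ ∀ φ ∈ utilityActs 𝒜 u, minVal c₀ φ ≤ maxVal b φ := by
  refine and_congr_right fun _ => ⟨fun h φ hφ => ?_, fun h f x hx => ?_⟩
  · obtain ⟨f, rfl⟩ := exists_comp_eq hφ
    obtain ⟨x, hx⟩ := exists_minVal_eq hu hc hφ
    exact hx.trans_le (h f x ((isCertaintyEquiv_iff hc hR).2 hx))
  · exact ((isCertaintyEquiv_iff hc hR).1 hx).symm.trans_le (h _ (comp_mem_utilityActs u f))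

theorem maxMinRep_Cstar [Nonempty S] [Nonempty Y]
    (hu : Convex ℝ (Set.range u)) (hc₀ : c₀ ∈ Penalties 𝒜)
    (hc : (⨅ p, c₀ p) = 0) (hR : VariationalRep R u c₀) : MaxMinRep R u (Cstar R u) := by
  have hmem : c₀ ∈ Cstar R u := (mem_Cstar_iff hu hc hR).2 ⟨hc₀, fun _ _ => le_rfl⟩
  refine ⟨fun c h => h.1, le_antisymm (iSup₂_le fun c h => ?_) ?_,
    fun f => minVal c₀ (f.comp u), fun f => ⟨⟨c₀, hmem, rfl⟩, ?_⟩, hR⟩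
  · obtain ⟨y⟩ := ‹Nonempty Y›
    have := ((mem_Cstar_iff hu hc hR).1 h).2 (SimpleFn.const 𝒜 (u y)) fun _ => ⟨y, rfl⟩
    rw [minVal_const, minVal_const, hc, add_zero] at this
    exact coe_add_le_coe_iff.1 this
  · exact hc.symm.trans_le (le_iSup₂ (f := fun c (_ : c ∈ Cstar R u) => ⨅ p, c p) c₀ hmem)
  · rintro _ ⟨c, h, rfl⟩
    exact ((mem_Cstar_iff hu hc hR).1 h).2 _ (comp_mem_utilityActs u f)

/-- Groundedness bounds `V` at a constant act by its utility, and `V f` does not exceed `V` at a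
certainty equivalent. -/
theorem MaxMinRep.subset_Cstar {C : Set (FAProb 𝒜 → EReal)} (hC : MaxMinRep R u C) :
    C ⊆ Cstar R u := by
  obtain ⟨hCP, hg, V, hV, hRV⟩ := hC
  refine fun c h => ⟨hCP h, fun f x hx => ?_⟩
  obtain ⟨c', hc', hV'⟩ := (hV (SimpleFn.const 𝒜 x)).1
  calc minVal c (f.comp u) ≤ V f := (hV f).2 ⟨c, h, rfl⟩
    _ ≤ V (SimpleFn.const 𝒜 x) := (hRV _ _).1 hx.1
    _ = minVal c' (SimpleFn.const 𝒜 (u x)) := hV'.symm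
    _ = u x + ⨅ p, c' p := minVal_const c' (u x)
    _ ≤ u x := coe_add_le_coe_iff.2
      ((le_iSup₂ (f := fun c (_ : c ∈ C) => ⨅ p, c p) c' hc').trans_eq hg)

theorem Cstar_eq [Nonempty S] (hu : Convex ℝ (Set.range u)) (hc₀ : c₀ ∈ Penalties 𝒜)
    (hne : (utilityActs 𝒜 u).Nonempty) (hc : (⨅ p, c₀ p) = 0) (hR : VariationalRep R u c₀) :
    Cstar R u = {c ∈ Penalties 𝒜 | ∃ c₁ ∈ Penalties 𝒜, UEquiv u c c₁ ∧ c₁ ≤ c₀} := by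
  ext c
  rw [mem_Cstar_iff hu hc hR]
  refine and_congr_right fun hcP => ⟨fun h => ?_, ?_⟩
  · have hv : ∀ φ ∈ utilityActs 𝒜 u, minVal c φ = ((minVal c φ).toReal : EReal) := by
      intro φ hφ
      obtain ⟨x, hx⟩ := exists_minVal_eq hu hc hφ
      exact (EReal.coe_toReal (ne_top_of_le_ne_top (EReal.coe_ne_top (u x))
        ((h φ hφ).trans_eq hx)) (minVal_ne_bot hcP φ)).symm
    exact ⟨envelope (utilityActs 𝒜 u) fun φ => (minVal c φ).toReal,
      envelope_mem_penalties hne _, fun φ hφ => (minVal_envelope hcP.1 hv hφ).symm,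
      envelope_le hc₀.1 fun φ hφ => (hv φ hφ).symm.trans_le (h φ hφ)⟩
  · rintro ⟨c₁, -, heq, hle⟩ φ hφ
    exact (heq φ hφ).trans_le (minVal_mono hle φ)

/-! ### The greatest min-max representation -/

/-- The dual penalty `q ↦ ∫ φ dq - t`. -/
noncomputable def affinePenalty (φ : SimpleFn 𝒜 ℝ) (t : ℝ) (q : FAProb 𝒜) : EReal :=
  ((q.integral φ - t : ℝ) : EReal)

theorem affinePenalty_mem_penalties (φ : SimpleFn 𝒜 ℝ) (t : ℝ) :
    affinePenalty φ t ∈ Penalties 𝒜 := by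
  refine ⟨fun p => EReal.coe_ne_bot _, ?_, fun p q a h0 h1 => ?_⟩
  · exact (continuous_coe_real_ereal.comp
      ((FAProb.continuous_integral φ).sub continuous_const)).lowerSemicontinuous
  · rw [affinePenalty, affinePenalty, affinePenalty, ← EReal.coe_mul, ← EReal.coe_mul,
      ← EReal.coe_add, FAProb.integral_mix]
    exact EReal.coe_le_coe_iff.2 (le_of_eq (by ring))

theorem maxVal_affinePenalty [Nonempty (FAProb 𝒜)] (φ : SimpleFn 𝒜 ℝ) (t : ℝ) :
    maxVal (affinePenalty φ t) φ = t := by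
  simp only [maxVal, affinePenalty, ← EReal.coe_sub, sub_sub_cancel, iSup_const]

/-- The right side is `t + sup_q ∫ (ψ - φ) dq`, and replacing `φ` by `ψ` raises `minVal c` by at
most that supremum. -/
theorem minVal_le_maxVal_affinePenalty {c : FAProb 𝒜 → EReal} (hc : ∀ p, c p ≠ ⊥)
    {φ : SimpleFn 𝒜 ℝ} {t : ℝ} (ht : minVal c φ = t) (ψ : SimpleFn 𝒜 ℝ) :
    minVal c ψ ≤ maxVal (affinePenalty φ t) ψ := by
  refine EReal.le_of_forall_lt_iff_le.1 fun z hz => ?_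
  refine EReal.ge_of_forall_gt_iff_ge.1 fun y hy => EReal.coe_le_coe_iff.2 ?_
  by_contra! hzy
  have hlt : ¬ ((t + (y - z) : ℝ) : EReal) ≤ minVal c φ := by
    rw [ht, EReal.coe_le_coe_iff]
    linarith
  refine hlt ((coe_le_minVal_iff hc).2 fun p r hr => ?_)
  have h1 := (coe_le_minVal_iff hc).1 hy.le p r hr
  have h2 := (le_maxVal (φ := ψ) (b := affinePenalty φ t) (p := p) rfl).trans hz.le
  rw [EReal.coe_le_coe_iff] at h2
  linarith

theorem affinePenalty_mem_Bstar [Nonempty S] (hu : Convex ℝ (Set.range u))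
    (hc₀ : c₀ ∈ Penalties 𝒜)
    (hc : (⨅ p, c₀ p) = 0) (hR : VariationalRep R u c₀) {φ : SimpleFn 𝒜 ℝ} {t : ℝ}
    (ht : minVal c₀ φ = t) : affinePenalty φ t ∈ Bstar R u :=
  (mem_Bstar_iff hu hc hR).2 ⟨affinePenalty_mem_penalties φ t,
    fun ψ _ => minVal_le_maxVal_affinePenalty hc₀.1 ht ψ⟩

theorem minMaxRep_Bstar [Nonempty S] [Nonempty Y]
    (hu : Convex ℝ (Set.range u)) (hc₀ : c₀ ∈ Penalties 𝒜)
    (hc : (⨅ p, c₀ p) = 0) (hR : VariationalRep R u c₀) : MinMaxRep R u (Bstar R u) := by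
  obtain ⟨y⟩ := ‹Nonempty Y›
  -- Over an empty `Δ` the infimum of `c₀` would be `⊤`, not `0`.
  have hΔ : Nonempty (FAProb 𝒜) := by
    by_contra h
    rw [not_nonempty_iff] at h
    rw [iInf_of_empty] at hc
    exact EReal.top_ne_zero hc
  refine ⟨fun b h => h.1, le_antisymm (iSup₂_le fun b h => ?_) ?_,
    fun f => minVal c₀ (f.comp u), fun f => ⟨?_, ?_⟩, hR⟩
  · have := ((mem_Bstar_iff hu hc hR).1 h).2 (SimpleFn.const 𝒜 (u y)) fun _ => ⟨y, rfl⟩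
    rw [minVal_const, maxVal_const, hc, add_zero] at this
    exact coe_le_coe_sub_iff.1 this
  -- For a constant act this penalty is identically `0`, so the supremum reaches `0`.
  · have hmem := affinePenalty_mem_Bstar hu hc₀ hc hR (φ := SimpleFn.const 𝒜 (u y)) (t := u y)
      (by rw [minVal_const, hc, add_zero])
    refine le_trans (le_of_eq ?_)
      (le_iSup₂ (f := fun b (_ : b ∈ Bstar R u) => ⨅ p, b p) _ hmem)
    simp [affinePenalty, FAProb.integral_const]
  · obtain ⟨x, hx⟩ := exists_minVal_eq hu hc (comp_mem_utilityActs u f)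
    exact ⟨_, affinePenalty_mem_Bstar hu hc₀ hc hR hx,
      (maxVal_affinePenalty (f.comp u) (u x)).trans hx.symm⟩
  · rintro _ ⟨b, h, rfl⟩
    exact ((mem_Bstar_iff hu hc hR).1 h).2 _ (comp_mem_utilityActs u f)

theorem MinMaxRep.subset_Bstar {B : Set (FAProb 𝒜 → EReal)} (hB : MinMaxRep R u B) :
    B ⊆ Bstar R u := by
  obtain ⟨hBP, hg, V, hV, hRV⟩ := hB
  refine fun b h => ⟨hBP h, fun f x hx => ?_⟩
  obtain ⟨b', hb', hV'⟩ := (hV (SimpleFn.const 𝒜 x)).1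
  calc (u x : EReal) ≤ u x - ⨅ p, b' p := coe_le_coe_sub_iff.2
        ((le_iSup₂ (f := fun b (_ : b ∈ B) => ⨅ p, b p) b' hb').trans_eq hg)
    _ = maxVal b' (SimpleFn.const 𝒜 (u x)) := (maxVal_const b' (u x)).symm
    _ = V (SimpleFn.const 𝒜 x) := hV'
    _ ≤ V f := (hRV _ _).1 hx.2
    _ ≤ maxVal b (f.comp u) := (hV f).2 ⟨b, h, rfl⟩

/-- Weak duality: at a single `p` the two objectives differ by `b p + c p`, which can be made
smaller than any positive gap. -/
theorem minVal_le_maxVal_of_iInf_add_nonpos {b c : FAProb 𝒜 → EReal} (hb : ∀ p, b p ≠ ⊥)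
    (hc : ∀ p, c p ≠ ⊥) (h : (⨅ p, b p + c p) ≤ 0) (φ : SimpleFn 𝒜 ℝ) :
    minVal c φ ≤ maxVal b φ := by
  refine EReal.le_of_forall_lt_iff_le.1 fun z hz => ?_
  refine EReal.ge_of_forall_gt_iff_ge.1 fun y hy => EReal.coe_le_coe_iff.2 ?_
  by_contra! hzy
  obtain ⟨p, hp⟩ := iInf_lt_iff.1 (h.trans_lt (EReal.coe_pos.2 (sub_pos.2 hzy)))
  induction hbp : b p with
  | bot => exact hb p hbp
  | top =>
    rw [hbp, EReal.top_add_of_ne_bot (hc p)] at hp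
    exact not_top_lt hp
  | coe s =>
    induction hcp : c p with
    | bot => exact hc p hcp
    | top =>
      rw [hcp, hbp, EReal.coe_add_top] at hp
      exact not_top_lt hp
    | coe r =>
      rw [hbp, hcp, ← EReal.coe_add, EReal.coe_lt_coe_iff] at hp
      have h1 := (coe_le_minVal_iff hc).1 hy.le p r hcp
      have h2 := EReal.coe_le_coe_iff.1 ((le_maxVal (φ := φ) hbp).trans hz.le)
      linarith

/-- The domination by `maxVal b` is known only on utility-valued functions, so `c₀` is replaced by
its envelope over them. The minimax step applies because they form a convex set on which `minVal c₀`
is concave. -/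
theorem Bstar_eq [Nonempty S] (hu : Convex ℝ (Set.range u)) (hc₀ : c₀ ∈ Penalties 𝒜)
    (hne : (utilityActs 𝒜 u).Nonempty) (hc : (⨅ p, c₀ p) = 0) (hR : VariationalRep R u c₀) :
    Bstar R u = {b ∈ Penalties 𝒜 | ∃ c ∈ Penalties 𝒜,
      UEquiv u c c₀ ∧ (⨅ p, b p + c p) ≤ 0} := by
  ext b
  rw [mem_Bstar_iff hu hc hR]
  refine and_congr_right fun hb => ⟨fun h => ?_, ?_⟩
  · have hv : ∀ φ ∈ utilityActs 𝒜 u, minVal c₀ φ = ((minVal c₀ φ).toReal : EReal) := by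
      intro φ hφ
      obtain ⟨x, hx⟩ := exists_minVal_eq hu hc hφ
      rw [hx, EReal.toReal_coe]
    refine ⟨envelope (utilityActs 𝒜 u) fun φ => (minVal c₀ φ).toReal,
      envelope_mem_penalties hne _, fun φ hφ => minVal_envelope hc₀.1 hv hφ,
      iInf_add_envelope_nonpos hb hne
        (fun t w hw => linComb_mem_utilityActs hu hw fun i => i.1.2) (fun t w hw => ?_)
        fun φ hφ => (hv φ hφ).symm.trans_le (h φ hφ)⟩
    refine EReal.coe_le_coe_iff.1 ?_
    rw [← hv _ (linComb_mem_utilityActs hu hw fun i => i.1.2)]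
    exact sum_le_minVal_linComb hc₀.1 hw fun i => (hv _ i.1.2).symm.le
  · rintro ⟨c, hcP, heq, hle⟩ φ hφ
    exact (heq φ hφ).symm.trans_le (minVal_le_maxVal_of_iInf_add_nonpos hb.1 hcP.1 hle φ)

end Preference

end NiveloidalPref

theorem mainTheorem4 {S : Type*} [Nonempty S] (𝒜 : BooleanSubalgebra (Set S))
    {E : Type*} [AddCommGroup E] [Module ℝ E] (X : Set E) (hX : Convex ℝ X)
    (R : NiveloidalPref.SimpleFn 𝒜 X → NiveloidalPref.SimpleFn 𝒜 X → Prop)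
    (u : X → ℝ) (hu : NiveloidalPref.IsAffineOn u) (hu' : ∃ x y, u x ≠ u y)
    (c₀ : NiveloidalPref.FAProb 𝒜 → EReal) (hc₀ : c₀ ∈ NiveloidalPref.Penalties 𝒜)
    (hc₀' : NiveloidalPref.Grounded {c₀}) (hR : NiveloidalPref.VariationalRep R u c₀) :
    (IsGreatest {C | NiveloidalPref.MaxMinRep R u C} (NiveloidalPref.Cstar R u) ∧
      NiveloidalPref.Cstar R u =
        {c ∈ NiveloidalPref.Penalties 𝒜 | ∃ c₁ ∈ NiveloidalPref.Penalties 𝒜,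
          NiveloidalPref.UEquiv u c c₁ ∧ c₁ ≤ c₀}) ∧
    (IsGreatest {B | NiveloidalPref.MinMaxRep R u B} (NiveloidalPref.Bstar R u) ∧
      NiveloidalPref.Bstar R u =
        {b ∈ NiveloidalPref.Penalties 𝒜 | ∃ ĉ ∈ NiveloidalPref.Penalties 𝒜,
          NiveloidalPref.UEquiv u ĉ c₀ ∧ (⨅ p, b p + ĉ p) ≤ 0}) := by
  obtain ⟨x₀, -⟩ := hu'
  have hY : Nonempty X := ⟨x₀⟩
  have hconv := NiveloidalPref.IsAffineOn.convex_range hX hu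
  have hc : (⨅ p, c₀ p) = 0 := by simpa [NiveloidalPref.Grounded] using hc₀'
  have hne : (NiveloidalPref.utilityActs 𝒜 u).Nonempty :=
    ⟨NiveloidalPref.SimpleFn.const 𝒜 (u x₀), fun _ => ⟨x₀, rfl⟩⟩
  exact ⟨⟨⟨NiveloidalPref.maxMinRep_Cstar hconv hc₀ hc hR, fun C hC => hC.subset_Cstar⟩,
      NiveloidalPref.Cstar_eq hconv hc₀ hne hc hR⟩,
    ⟨NiveloidalPref.minMaxRep_Bstar hconv hc₀ hc hR, fun B hB => hB.subset_Bstar⟩,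
      NiveloidalPref.Bstar_eq hconv hc₀ hne hc hR⟩
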